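/- Let $d\ge 1$. There is a constant $A_d>0$, depending only on $d$, with the following property. Let $\mathcal X\subset\mathbb R^d$ be bounded, let $\bar\mu$ be a probability measure concentrated on $\mathcal X$, put $H=L^2(\bar\mu;\mathbb R^d)$ and $A_{\mathcal X}:=A_d\operatorname{diam}(\mathcal X)$. Let $V$ be a (jointly measurable) random vector field on $\mathcal X$ with values in $\mathbb R^d$ and $\mathbb E\|V(x)\|^2<\infty$ for all $x\in\mathcal X$; for instance the random tangent field $V=T-\mathrm{Id}$, where $T$ is the optimal transport map from $\bar\mu$ to a random distribution. Let $\mathcal K(x,y)=\mathbb E[V(x)V(y)^\top]$ be its covariance kernel and $\Gamma=\mathbb E[V\otimes V]:H\to H$, $(a\otimes b)f=\langle f,b\rangle_H\,a$, its covariance operator. (i) If almost surely $V$ is $L$-Lipschitz on $\mathcal X$, and $\mathbb E\|V(z)\|^2\le B_2^2$ for all $z\in\mathcal X$, then $$\|\mathcal K(x,y)-\mathcal K(x',y')\|_F\le C_{\mathcal K}\,(\|x-x'\|+\|y-y'\|)\qquad(x,y,x',y'\in\mathcal X)\tag{$*$}$$ holds with $C_{\mathcal K}=LB_2$. (ii)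 Suppose that $(*)$ holds with some constant $C_{\mathcal K}\ge 0$. Let $\lambda_1\ge\lambda_2\ge\dots\ge 0$ be the eigenvalues of $\Gamma$, repeated according to multiplicity (and padded with zeros if $\Gamma$ has finite rank), with eigenvectors $\phi_m$, those for nonzero eigenvalues being orthonormal. Then $\sum_m\lambda_m<\infty$, and for every integer $K\ge d$ $$\sum_{m>K}\lambda_m\le A_{\mathcal X}\,C_{\mathcal K}\,K^{-1/d}.$$ Consequently, if $\operatorname{tr}\Gamma>0$ and $\varepsilon>0$, then for every integer $K\ge d$ with $$K\ge\Big(\frac{A_{\mathcal X}C_{\mathcal K}}{\varepsilon^2\operatorname{tr}\Gamma}\Big)^d$$ the orthogonal projection $P_K$ of $H$ onto $\operatorname{span}\{\phi_1,\dots,\phi_K\}$ satisfies $\mathbb E\|V-P_KV\|_H^2\le\varepsilon^2\,\mathbb E\|V\|_H^2<\infty$, that is, the relative mean-square reconstruction error is at most $\varepsilon^2$. -/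

import Mathlib

open MeasureTheory InnerProductSpace

noncomputable section

/-- The covariance kernel `K(x, y) = E[V(x) V(y)ᵀ]` of a random vector field `V`. -/
def covKernel {Ω : Type*} [MeasurableSpace Ω] {d : ℕ} (P : Measure Ω)
    (V : Ω → EuclideanSpace ℝ (Fin d) → EuclideanSpace ℝ (Fin d))
    (x y : EuclideanSpace ℝ (Fin d)) : Matrix (Fin d) (Fin d) ℝ :=
  Matrix.of fun i j => ∫ ω, V ω x i * V ω y j ∂P

section
open scoped Matrix.Norms.Frobenius

/-- `‖k(x, y) - k(x', y')‖_F ≤ C (‖x - x'‖ + ‖y - y'‖)` on `X × X`, in the Frobenius norm. -/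
def KernelLipschitzOn {d : ℕ} (X : Set (EuclideanSpace ℝ (Fin d)))
    (k : EuclideanSpace ℝ (Fin d) → EuclideanSpace ℝ (Fin d) → Matrix (Fin d) (Fin d) ℝ)
    (C : ℝ) : Prop :=
  ∀ x ∈ X, ∀ y ∈ X, ∀ x' ∈ X, ∀ y' ∈ X,
    ‖k x y - k x' y'‖ ≤ C * (‖x - x'‖ + ‖y - y'‖)

end

/-- The Hilbert space `H = L²(μ; ℝᵈ)`. -/
abbrev FieldSpace {d : ℕ} (μ : Measure (EuclideanSpace ℝ (Fin d))) : Type :=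
  Lp (EuclideanSpace ℝ (Fin d)) 2 μ

open scoped Classical in
/-- A vector field as an element of `H` (with value `0` if it is not square-integrable). -/
def fieldToLp {d : ℕ} (μ : Measure (EuclideanSpace ℝ (Fin d)))
    (v : EuclideanSpace ℝ (Fin d) → EuclideanSpace ℝ (Fin d)) : FieldSpace μ :=
  if h : MemLp v 2 μ then h.toLp v else 0

/-- The covariance operator `Γ = E[V ⊗ V]` on `H`, with `(a ⊗ b) f = ⟪f, b⟫ a`, as a Bochner
integral of rank-one operators. Like the kernel `E[V(x) V(y)ᵀ]` it is not centred; the two are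
the usual covariances when `V` has mean zero. -/
def covOp {Ω : Type*} [MeasurableSpace Ω] {d : ℕ} (P : Measure Ω)
    (μ : Measure (EuclideanSpace ℝ (Fin d)))
    (V : Ω → EuclideanSpace ℝ (Fin d) → EuclideanSpace ℝ (Fin d)) :
    FieldSpace μ →L[ℝ] FieldSpace μ :=
  ∫ ω, rankOne ℝ (fieldToLp μ (V ω)) (fieldToLp μ (V ω)) ∂P

/-- The trace `∑ i, ⟪b i, Γ (b i)⟫` along a Hilbert basis of `H`; for positive `Γ` it does not
depend on the basis. -/
def opTrace {H : Type*} [NormedAddCommGroup H] [InnerProductSpace ℝ H] [CompleteSpace H]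
    (Γ : H →L[ℝ] H) : ℝ :=
  ∑' i, inner ℝ ((exists_hilbertBasis ℝ H).choose_spec.choose i)
    (Γ ((exists_hilbertBasis ℝ H).choose_spec.choose i))

/-- `lam 0 ≥ lam 1 ≥ ...` are the eigenvalues of the positive compact operator `Γ`, repeated
according to multiplicity and padded with zeros if `Γ` has finite rank, and `φ m` is an
eigenvector for `lam m`, the eigenvectors for nonzero eigenvalues being orthonormal. The last
field says that no nonzero eigenvalue, and no part of its eigenspace, is missing. (The vectors
`φ m` with `lam m = 0` are not required to be orthonormal, because `H` may be
finite-dimensional.) -/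
structure IsEigenSystem {H : Type*} [NormedAddCommGroup H] [InnerProductSpace ℝ H]
    (Γ : H →L[ℝ] H) (lam : ℕ → ℝ) (φ : ℕ → H) : Prop where
  antitone : Antitone lam
  apply_eq : ∀ m, Γ (φ m) = lam m • φ m
  orthonormal : Orthonormal ℝ fun m : {m : ℕ // lam m ≠ 0} => φ m
  complete : ∀ s : ℝ, s ≠ 0 →
    Module.End.eigenspace (Γ : H →ₗ[ℝ] H) s ≤ Submodule.span ℝ (φ '' {m | lam m = s})

open scoped Classical in
/-- The span of the first `K` principal directions `φ 0, ..., φ (K - 1)`. -/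
def principalSpan {H : Type*} [NormedAddCommGroup H] [InnerProductSpace ℝ H]
    (φ : ℕ → H) (K : ℕ) : Submodule ℝ H :=
  Submodule.span ℝ (((Finset.range K).image φ : Finset H) : Set H)

instance {H : Type*} [NormedAddCommGroup H] [InnerProductSpace ℝ H] (φ : ℕ → H) (K : ℕ) :
    FiniteDimensional ℝ (principalSpan φ K) := by
  classical
  exact FiniteDimensional.span_finset ℝ _

/-- The squared norm `‖V - P_K V‖²_H` of the residual of a field after orthogonal projection
onto the first `K` principal directions. -/
def residualSq {d : ℕ} (μ : Measure (EuclideanSpace ℝ (Fin d))) (φ : ℕ → FieldSpace μ) (K : ℕ)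
    (v : EuclideanSpace ℝ (Fin d) → EuclideanSpace ℝ (Fin d)) : ℝ :=
  ‖fieldToLp μ v - (principalSpan φ K).starProjection (fieldToLp μ v)‖ ^ 2

end

/-! The eigenvalue tail after `K` terms is the least mean-square error in approximating the random
element `V` of `H` from a subspace of dimension at most `K`, so any explicit subspace bounds it.

Variational half (`IsEigenSystem.tsum_tail_le`): with `w m` the squared norm of the projection onto
`G` of the `m`-th eigenvector, the error of `G` is at least `∑ lam m * (1 - w m)`. The weights lie
in `[0, 1]` and have total mass at most `dim G ≤ K`, so against a decreasing sequence they remove at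
most the sum of the first `K` eigenvalues.

Geometric half (`KernelLipschitzOn.integral_norm_sub_fibrewiseConst_le`): take the fields constant
on each of the `n ^ d` cells of a grid, a space of dimension at most `d * n ^ d`. Since `E‖V x - V
y‖²` is the trace of two kernel differences, it is at most `2 √d C ‖x - y‖`. The error is thus
linear in the cell diameter, which is of order `1 / n`, and `n` of order `(K / d) ^ (1 / d)` gives
the rate.

For the reconstruction error, `V` lies almost surely in the closed span of the eigenvectors with
nonzero eigenvalue, so the residual of the first `K` directions is at most the tail. Eigenvectors
for the eigenvalue zero need not be orthonormal; `nonzeroPart` sets them to zero, so that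
orthogonality and Bessel hold over all indices. -/

noncomputable section

/-! ### Second moment operators of random vectors -/

section SecondMoment

variable {H : Type*} [NormedAddCommGroup H] [InnerProductSpace ℝ H]
  {Ω : Type*} [MeasurableSpace Ω] {P : Measure Ω} {Z : Ω → H}

/-- The second moment operator `E[Z ⊗ Z]` of a random vector `Z`. -/
def secondMomentOp (P : Measure Ω) (Z : Ω → H) : H →L[ℝ] H :=
  ∫ ω, rankOne ℝ (Z ω) (Z ω) ∂P

theorem integrable_rankOne_self (hZ : MemLp Z 2 P) :
    Integrable (fun ω => rankOne ℝ (Z ω) (Z ω)) P := by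
  have hc : Continuous fun z : H => rankOne ℝ z z :=
    (rankOne ℝ (E := H) (F := H)).continuous.clm_apply continuous_id
  refine (hZ.integrable_norm_pow (by norm_num)).mono'
    (hc.comp_aestronglyMeasurable hZ.1) (Filter.Eventually.of_forall fun ω => ?_)
  simp [sq]

theorem integrable_inner_mul_inner (hZ : MemLp Z 2 P) (f g : H) :
    Integrable (fun ω => inner ℝ f (Z ω) * inner ℝ g (Z ω)) P :=
  (hZ.const_inner f).integrable_mul (hZ.const_inner g)

theorem inner_secondMomentOp [CompleteSpace H] (hZ : MemLp Z 2 P) (f g : H) :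
    inner ℝ f (secondMomentOp P Z g) = ∫ ω, inner ℝ f (Z ω) * inner ℝ g (Z ω) ∂P := by
  have h := ((innerSL ℝ f).comp (ContinuousLinearMap.apply ℝ H g)).integral_comp_comm
    (integrable_rankOne_self hZ)
  rw [secondMomentOp]
  refine Eq.trans h.symm (integral_congr_ae (Filter.Eventually.of_forall fun ω => ?_))
  simp [real_inner_comm, mul_comm]

theorem inner_secondMomentOp_self [CompleteSpace H] (hZ : MemLp Z 2 P) (f : H) :
    inner ℝ f (secondMomentOp P Z f) = ∫ ω, inner ℝ f (Z ω) ^ 2 ∂P := by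
  simp_rw [inner_secondMomentOp hZ, sq]

theorem isSymmetric_secondMomentOp [CompleteSpace H] (hZ : MemLp Z 2 P) :
    (secondMomentOp P Z : H →ₗ[ℝ] H).IsSymmetric := by
  intro f g
  simp only [ContinuousLinearMap.coe_coe]
  rw [real_inner_comm, inner_secondMomentOp hZ, inner_secondMomentOp hZ]
  simp_rw [mul_comm]

/-- The compact operators form a closed convex set, so the mean of the random rank-one operators
stays in it. -/
theorem isCompactOperator_secondMomentOp [CompleteSpace H] [IsProbabilityMeasure P]
    (hZ : MemLp Z 2 P) : IsCompactOperator (secondMomentOp P Z) := by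
  refine Convex.integral_mem (s := {T : H →L[ℝ] H | IsCompactOperator T}) ?_
    isClosed_setOfPred_isCompactOperator (Filter.Eventually.of_forall fun ω => ?_)
    (integrable_rankOne_self hZ)
  · intro S hS T hT a b _ _ _
    exact (IsCompactOperator.smul hS a).add (IsCompactOperator.smul hT b)
  · have h := isCompactOperator_of_locallyCompactSpace_rng
      (ContinuousLinearMap.toSpanSingleton ℝ (Z ω))
    exact h.comp_clm (innerSL ℝ (Z ω))

/-- The trace of the second moment operator is at most the second moment. -/
theorem opTrace_secondMomentOp_le [CompleteSpace H] (hZ : MemLp Z 2 P) :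
    opTrace (secondMomentOp P Z) ≤ ∫ ω, ‖Z ω‖ ^ 2 ∂P := by
  unfold opTrace
  generalize (exists_hilbertBasis ℝ H).choose_spec.choose = b
  -- Bessel bounds every finite partial sum, so summability need not be known.
  refine tsum_le_of_sum_le' (integral_nonneg fun ω => by positivity) fun s => ?_
  simp_rw [inner_secondMomentOp_self hZ]
  rw [← integral_finsetSum _ fun i _ => (hZ.const_inner (b i)).integrable_sq]
  refine integral_mono (integrable_finsetSum _ fun i _ => (hZ.const_inner (b i)).integrable_sq)
    (hZ.integrable_norm_pow (by norm_num)) fun ω => ?_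
  simpa using b.orthonormal.sum_inner_products_le (Z ω) (s := s)

end SecondMoment

/-! ### Eigensystems: Bessel, Parseval, completeness -/

section NonzeroPart

variable {H : Type*} [NormedAddCommGroup H] {lam : ℕ → ℝ} {φ : ℕ → H}

open scoped Classical in
/-- The vectors of an eigensystem, with those for the eigenvalue zero replaced by zero. -/
def nonzeroPart (lam : ℕ → ℝ) (φ : ℕ → H) (m : ℕ) : H :=
  if lam m = 0 then 0 else φ m

theorem nonzeroPart_of_ne {m : ℕ} (h : lam m ≠ 0) : nonzeroPart lam φ m = φ m := if_neg h

theorem nonzeroPart_of_eq {m : ℕ} (h : lam m = 0) : nonzeroPart lam φ m = 0 := if_pos h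

end NonzeroPart

section EigenSystem

variable {H : Type*} [NormedAddCommGroup H] [InnerProductSpace ℝ H]
  {Γ : H →L[ℝ] H} {lam : ℕ → ℝ} {φ : ℕ → H}

namespace IsEigenSystem

theorem apply_nonzeroPart (hE : IsEigenSystem Γ lam φ) (m : ℕ) :
    Γ (nonzeroPart lam φ m) = lam m • nonzeroPart lam φ m := by
  by_cases h : lam m = 0
  · simp [nonzeroPart_of_eq h]
  · rw [nonzeroPart_of_ne h, hE.apply_eq]

theorem inner_nonzeroPart_of_ne (hE : IsEigenSystem Γ lam φ) {m n : ℕ} (h : m ≠ n) :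
    inner ℝ (nonzeroPart lam φ m) (nonzeroPart lam φ n) = 0 := by
  by_cases hm : lam m = 0
  · simp [nonzeroPart_of_eq hm]
  by_cases hn : lam n = 0
  · simp [nonzeroPart_of_eq hn]
  rw [nonzeroPart_of_ne hm, nonzeroPart_of_ne hn]
  exact hE.orthonormal.2 (i := ⟨m, hm⟩) (j := ⟨n, hn⟩) (by simpa using h)

theorem norm_nonzeroPart (hE : IsEigenSystem Γ lam φ) {m : ℕ} (h : lam m ≠ 0) :
    ‖nonzeroPart lam φ m‖ = 1 := by
  rw [nonzeroPart_of_ne h]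
  exact hE.orthonormal.1 ⟨m, h⟩

theorem norm_nonzeroPart_le (hE : IsEigenSystem Γ lam φ) (m : ℕ) :
    ‖nonzeroPart lam φ m‖ ≤ 1 := by
  by_cases h : lam m = 0
  · simp [nonzeroPart_of_eq h]
  · exact (hE.norm_nonzeroPart h).le

theorem inner_nonzeroPart_smul (hE : IsEigenSystem Γ lam φ) (m : ℕ) (x : H) :
    inner ℝ (nonzeroPart lam φ m) x * inner ℝ (nonzeroPart lam φ m) (nonzeroPart lam φ m)
      = inner ℝ (nonzeroPart lam φ m) x := by
  by_cases h : lam m = 0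
  · simp [nonzeroPart_of_eq h]
  · rw [real_inner_self_eq_norm_sq, hE.norm_nonzeroPart h]; ring

theorem mul_norm_nonzeroPart (hE : IsEigenSystem Γ lam φ) (m : ℕ) :
    lam m * ‖nonzeroPart lam φ m‖ ^ 2 = lam m := by
  by_cases h : lam m = 0
  · simp [h]
  · rw [hE.norm_nonzeroPart h]; ring

/-- Pythagoras for the expansion in the vectors of an eigensystem. -/
theorem norm_sub_sum_sq (hE : IsEigenSystem Γ lam φ) (s : Finset ℕ) (x : H) :
    ‖x - ∑ m ∈ s, inner ℝ (nonzeroPart lam φ m) x • nonzeroPart lam φ m‖ ^ 2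
      = ‖x‖ ^ 2 - ∑ m ∈ s, inner ℝ (nonzeroPart lam φ m) x ^ 2 := by
  have h1 : inner ℝ x (∑ m ∈ s, inner ℝ (nonzeroPart lam φ m) x • nonzeroPart lam φ m)
      = ∑ m ∈ s, inner ℝ (nonzeroPart lam φ m) x ^ 2 := by
    rw [inner_sum]
    refine Finset.sum_congr rfl fun m _ => ?_
    rw [inner_smul_right, real_inner_comm, sq]
  have h2 : ‖∑ m ∈ s, inner ℝ (nonzeroPart lam φ m) x • nonzeroPart lam φ m‖ ^ 2
      = ∑ m ∈ s, inner ℝ (nonzeroPart lam φ m) x ^ 2 := by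
    rw [← real_inner_self_eq_norm_sq, sum_inner]
    refine Finset.sum_congr rfl fun m hm => ?_
    rw [inner_sum, Finset.sum_eq_single_of_mem m hm]
    · rw [inner_smul_left, inner_smul_right, hE.inner_nonzeroPart_smul]
      simp [sq]
    · intro n _ hn
      rw [inner_smul_left, inner_smul_right, hE.inner_nonzeroPart_of_ne hn.symm]
      simp
  rw [norm_sub_sq_real, h1, h2]
  ring

/-- Bessel's inequality for the vectors of an eigensystem. -/
theorem sum_inner_sq_le (hE : IsEigenSystem Γ lam φ) (s : Finset ℕ) (x : H) :
    ∑ m ∈ s, inner ℝ (nonzeroPart lam φ m) x ^ 2 ≤ ‖x‖ ^ 2 := by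
  have h := hE.norm_sub_sum_sq s x
  have := sq_nonneg ‖x - ∑ m ∈ s, inner ℝ (nonzeroPart lam φ m) x • nonzeroPart lam φ m‖
  linarith

/-- Parseval's identity on the closed span of the vectors of an eigensystem. -/
theorem hasSum_inner_sq (hE : IsEigenSystem Γ lam φ) {x : H}
    (hx : x ∈ (Submodule.span ℝ (Set.range (nonzeroPart lam φ))).topologicalClosure) :
    HasSum (fun m => inner ℝ (nonzeroPart lam φ m) x ^ 2) (‖x‖ ^ 2) := by
  set ψ := nonzeroPart lam φ with hψ
  let T : ℕ → H → H := fun M y => y - ∑ m ∈ Finset.range M, inner ℝ (ψ m) y • ψ m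
  have hsub : ∀ M y z, T M (y - z) = T M y - T M z := by
    intro M y z
    simp only [T, inner_sub_right, sub_smul, Finset.sum_sub_distrib]
    abel
  have hsq : ∀ M y, ‖T M y‖ ^ 2 = ‖y‖ ^ 2 - ∑ m ∈ Finset.range M, inner ℝ (ψ m) y ^ 2 :=
    fun M y => hE.norm_sub_sum_sq _ y
  -- The remainders `T M` are contractions and eventually vanish on each vector of the span, hence
  -- tend to zero on its closure.
  have hle : ∀ M y, ‖T M y‖ ≤ ‖y‖ := by
    intro M y
    refine abs_le_of_sq_le_sq' ?_ (norm_nonneg y) |>.2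
    rw [hsq]
    have : 0 ≤ ∑ m ∈ Finset.range M, inner ℝ (ψ m) y ^ 2 :=
      Finset.sum_nonneg fun m _ => sq_nonneg _
    linarith
  have hspan : ∀ y ∈ Submodule.span ℝ (Set.range ψ), ∀ᶠ M in Filter.atTop, T M y = 0 := by
    intro y hy
    induction hy using Submodule.span_induction with
    | mem y hy =>
      obtain ⟨n, rfl⟩ := hy
      filter_upwards [Filter.eventually_gt_atTop n] with M hM
      have h1 : ∑ m ∈ Finset.range M, inner ℝ (ψ m) (ψ n) • ψ m
          = inner ℝ (ψ n) (ψ n) • ψ n := by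
        refine Finset.sum_eq_single_of_mem n (Finset.mem_range.2 hM) fun m _ hm => ?_
        rw [hE.inner_nonzeroPart_of_ne hm, zero_smul]
      simp only [T, h1]
      by_cases h : lam n = 0
      · simp [hψ, nonzeroPart_of_eq h]
      · rw [real_inner_self_eq_norm_sq, hE.norm_nonzeroPart h]; simp
    | zero => exact Filter.Eventually.of_forall fun M => by simp [T]
    | add y z _ _ hy hz =>
      filter_upwards [hy, hz] with M h1 h2
      have h3 := hsub M (y + z) z
      rw [add_sub_cancel_right, h1, h2] at h3
      simpa using h3.symm
    | smul a y _ hy =>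
      filter_upwards [hy] with M h1
      have : T M (a • y) = a • T M y := by
        simp only [T, inner_smul_right, smul_sub, Finset.smul_sum, smul_smul]
      rw [this, h1, smul_zero]
  have hlim : Filter.Tendsto (fun M => T M x) Filter.atTop (nhds 0) := by
    rw [Metric.tendsto_nhds]
    intro ε hε
    obtain ⟨y, hy, hxy⟩ := Metric.mem_closure_iff.1 hx ε hε
    filter_upwards [hspan y hy] with M hM
    have h := hsub M x y
    rw [hM, sub_zero] at h
    rw [dist_zero_right, ← h]
    exact (hle M _).trans_lt (by rwa [← dist_eq_norm])
  rw [hasSum_iff_tendsto_nat_of_nonneg (fun m => sq_nonneg _)]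
  have h := (hlim.norm.pow 2).const_sub (‖x‖ ^ 2)
  simp only [hsq] at h
  simpa using h

/-- A compact symmetric operator vanishes on the orthogonal complement of the vectors of an
eigensystem. -/
theorem apply_eq_zero_of_mem_orthogonal [CompleteSpace H]
    (hE : IsEigenSystem Γ lam φ) (hc : IsCompactOperator Γ)
    (hs : (Γ : H →ₗ[ℝ] H).IsSymmetric) {x : H}
    (hx : x ∈ (Submodule.span ℝ (Set.range (nonzeroPart lam φ)))ᗮ) : Γ x = 0 := by
  -- By the spectral theorem it suffices that `Γ x` is orthogonal to every eigenvector `u`. Symmetry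
  -- turns the inner product into `s * ⟪u, x⟫`, which vanishes for `s = 0`, and by completeness of
  -- the system otherwise.
  have hbot := ContinuousLinearMap.orthogonalComplement_iSup_eigenspaces_eq_bot hc hs
  rw [← Submodule.mem_bot ℝ, ← hbot, Submodule.iSup_eq_span, Submodule.mem_orthogonal]
  intro u hu
  induction hu using Submodule.span_induction with
  | mem u hu =>
    obtain ⟨s, hu⟩ := Set.mem_iUnion.1 hu
    have hu' : Γ u = s • u := Module.End.mem_eigenspace_iff.1 hu
    have h1 : inner ℝ u (Γ x) = inner ℝ (Γ u) x := (hs u x).symm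
    rw [h1, hu', inner_smul_left]
    by_cases h0 : s = 0
    · simp [h0]
    rw [(Submodule.mem_orthogonal _ _).1 hx u ?_, mul_zero]
    refine Submodule.span_mono ?_ (hE.complete s h0 hu)
    rintro _ ⟨m, hm, rfl⟩
    exact ⟨m, nonzeroPart_of_ne (by rw [Set.mem_ofPred_eq] at hm; rwa [hm])⟩
  | zero => simp
  | add u v _ _ h1 h2 => rw [inner_add_left, h1, h2, add_zero]
  | smul a u _ h => rw [inner_smul_left, h, mul_zero]

/-- Expand in an orthonormal basis of `G`, exchange the sums, and apply Bessel to each basis vector.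
This bounds the total mass of the weights in the variational argument. -/
theorem sum_norm_starProjection_sq_le (hE : IsEigenSystem Γ lam φ) (s : Finset ℕ)
    (G : Submodule ℝ H) [FiniteDimensional ℝ G] :
    ∑ m ∈ s, ‖G.starProjection (nonzeroPart lam φ m)‖ ^ 2 ≤ Module.finrank ℝ G := by
  let b := stdOrthonormalBasis ℝ G
  have h1 : ∀ x : H, ‖G.starProjection x‖ ^ 2 = ∑ j, inner ℝ x (b j : H) ^ 2 := by
    intro x
    have h := b.sum_sq_norm_inner_right (G.orthogonalProjectionOnto x)
    rw [Submodule.starProjection_apply, ← Submodule.coe_norm, ← h]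
    refine Finset.sum_congr rfl fun j _ => ?_
    rw [Submodule.coe_inner, ← Submodule.starProjection_apply,
      ← Submodule.inner_starProjection_left_eq_right,
      Submodule.starProjection_eq_self_iff.2 (b j).2, Real.norm_eq_abs, sq_abs, real_inner_comm]
  simp_rw [h1]
  rw [Finset.sum_comm]
  calc ∑ j, ∑ m ∈ s, inner ℝ (nonzeroPart lam φ m) (b j : H) ^ 2
      ≤ ∑ j, ‖(b j : H)‖ ^ 2 := Finset.sum_le_sum fun j _ => hE.sum_inner_sq_le s _
    _ = Module.finrank ℝ G := by
      have h2 : ∀ j, ‖(b j : H)‖ = 1 := fun j => b.orthonormal.1 j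
      simp [h2]

end IsEigenSystem

end EigenSystem

/-! ### The variational bound for eigenvalue tails -/

/-- A weighted sum of an antitone nonnegative sequence, with weights in `[0, 1]` of total mass at
most `K`, is at most the sum of the first `K` terms. -/
theorem sum_mul_le_sum_range_of_antitone {lam w : ℕ → ℝ} (hl : Antitone lam)
    (h0 : ∀ m, 0 ≤ lam m) (hw0 : ∀ m, 0 ≤ w m) (hw1 : ∀ m, w m ≤ 1) {K M : ℕ} (hKM : K ≤ M)
    (hw : ∑ m ∈ Finset.range M, w m ≤ K) :
    ∑ m ∈ Finset.range M, lam m * w m ≤ ∑ m ∈ Finset.range K, lam m := by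
  -- After subtracting `lam K`, terms before `K` are nonnegative and increase when `w m` is replaced
  -- by `1`; later terms are nonpositive and can be dropped.
  have h1 : ∑ m ∈ Finset.range M, (lam m - lam K) * w m
      ≤ ∑ m ∈ Finset.range K, (lam m - lam K) := by
    rw [← Finset.sum_range_add_sum_Ico _ hKM]
    have ha : ∑ m ∈ Finset.range K, (lam m - lam K) * w m
        ≤ ∑ m ∈ Finset.range K, (lam m - lam K) := by
      refine Finset.sum_le_sum fun m hm => ?_
      have : lam K ≤ lam m := hl (Finset.mem_range.1 hm).le
      nlinarith [hw1 m]
    have hb : ∑ m ∈ Finset.Ico K M, (lam m - lam K) * w m ≤ 0 := by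
      refine Finset.sum_nonpos fun m hm => ?_
      have : lam m ≤ lam K := hl (Finset.mem_Ico.1 hm).1
      nlinarith [hw0 m]
    linarith
  simp only [sub_mul, Finset.sum_sub_distrib, ← Finset.mul_sum, Finset.sum_const,
    Finset.card_range, nsmul_eq_mul] at h1
  nlinarith [mul_le_mul_of_nonneg_left hw (h0 K)]

theorem norm_sub_starProjection_le {H : Type*} [NormedAddCommGroup H] [InnerProductSpace ℝ H]
    {G : Submodule ℝ H} [G.HasOrthogonalProjection] {x y : H} (hy : y ∈ G) :
    ‖x - G.starProjection x‖ ≤ ‖x - y‖ := by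
  rw [G.starProjection_minimal]
  exact ciInf_le ⟨0, by rintro _ ⟨z, rfl⟩; positivity⟩ (⟨y, hy⟩ : G)

namespace IsEigenSystem

variable {H : Type*} [NormedAddCommGroup H] [InnerProductSpace ℝ H] [CompleteSpace H]
  {Ω : Type*} [MeasurableSpace Ω] {P : Measure Ω} {Z : Ω → H} {lam : ℕ → ℝ} {φ : ℕ → H}

theorem integral_inner_sq (hZ : MemLp Z 2 P) (hE : IsEigenSystem (secondMomentOp P Z) lam φ)
    (m : ℕ) : ∫ ω, inner ℝ (nonzeroPart lam φ m) (Z ω) ^ 2 ∂P = lam m := by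
  rw [← inner_secondMomentOp_self hZ, hE.apply_nonzeroPart, inner_smul_right,
    real_inner_self_eq_norm_sq, hE.mul_norm_nonzeroPart]

theorem nonneg (hZ : MemLp Z 2 P) (hE : IsEigenSystem (secondMomentOp P Z) lam φ)
    (m : ℕ) : 0 ≤ lam m := by
  rw [← hE.integral_inner_sq hZ]
  exact integral_nonneg fun ω => sq_nonneg _

theorem sum_le_integral (hZ : MemLp Z 2 P) (hE : IsEigenSystem (secondMomentOp P Z) lam φ)
    (s : Finset ℕ) : ∑ m ∈ s, lam m ≤ ∫ ω, ‖Z ω‖ ^ 2 ∂P := by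
  simp_rw [← hE.integral_inner_sq hZ]
  rw [← integral_finsetSum _ fun m _ => (hZ.const_inner _).integrable_sq]
  exact integral_mono (integrable_finsetSum _ fun m _ => (hZ.const_inner _).integrable_sq)
    (hZ.integrable_norm_pow (by norm_num)) fun ω => hE.sum_inner_sq_le s (Z ω)

/-- The eigenvalues of a second moment operator are summable. -/
theorem summable (hZ : MemLp Z 2 P) (hE : IsEigenSystem (secondMomentOp P Z) lam φ) :
    Summable lam :=
  summable_of_sum_le (hE.nonneg hZ) (hE.sum_le_integral hZ)

/-- The expected squared distance to a closed subspace bounds the weighted sum of the squared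
distances of the eigenvectors to this subspace. -/
theorem sum_mul_norm_sub_sq_le (hZ : MemLp Z 2 P)
    (hE : IsEigenSystem (secondMomentOp P Z) lam φ) (G : Submodule ℝ H)
    [G.HasOrthogonalProjection] (s : Finset ℕ) :
    ∑ m ∈ s, lam m * ‖nonzeroPart lam φ m - G.starProjection (nonzeroPart lam φ m)‖ ^ 2
      ≤ ∫ ω, ‖Z ω - G.starProjection (Z ω)‖ ^ 2 ∂P := by
  set ψ := nonzeroPart lam φ
  have hperp : ∀ x y : H, inner ℝ (x - G.starProjection x) (y - G.starProjection y)
      = inner ℝ (x - G.starProjection x) y := by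
    intro x y
    rw [inner_sub_right, G.starProjection_inner_eq_zero x _ (G.starProjection_apply_mem y),
      sub_zero]
  set e : ℕ → H := fun m => ψ m - G.starProjection (ψ m) with he
  have hY : MemLp (fun ω => Z ω - G.starProjection (Z ω)) 2 P :=
    hZ.sub (G.starProjection.comp_memLp' hZ)
  -- This is the expanded square of the distance from the residual of `Z ω` to the combination of
  -- the residuals `e m` with coefficients `⟪ψ m, Z ω⟫`.
  have hpt : ∀ ω, 2 * ∑ m ∈ s, inner ℝ (ψ m) (Z ω) * inner ℝ (e m) (Z ω)
      - ∑ m ∈ s, ∑ n ∈ s, inner ℝ (ψ m) (Z ω) * inner ℝ (ψ n) (Z ω) * inner ℝ (e m) (e n)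
      ≤ ‖Z ω - G.starProjection (Z ω)‖ ^ 2 := by
    intro ω
    have h := sq_nonneg ‖(Z ω - G.starProjection (Z ω))
      - ∑ m ∈ s, inner ℝ (ψ m) (Z ω) • e m‖
    rw [norm_sub_sq_real] at h
    have h1 : inner ℝ (Z ω - G.starProjection (Z ω)) (∑ m ∈ s, inner ℝ (ψ m) (Z ω) • e m)
        = ∑ m ∈ s, inner ℝ (ψ m) (Z ω) * inner ℝ (e m) (Z ω) := by
      rw [inner_sum]
      refine Finset.sum_congr rfl fun m _ => ?_
      have h3 : inner ℝ (Z ω - G.starProjection (Z ω)) (e m) = inner ℝ (e m) (Z ω) := by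
        rw [real_inner_comm]
        exact hperp _ _
      rw [inner_smul_right, h3]
    have h2 : ‖∑ m ∈ s, inner ℝ (ψ m) (Z ω) • e m‖ ^ 2 = ∑ m ∈ s, ∑ n ∈ s,
        inner ℝ (ψ m) (Z ω) * inner ℝ (ψ n) (Z ω) * inner ℝ (e m) (e n) := by
      rw [← real_inner_self_eq_norm_sq, sum_inner]
      refine Finset.sum_congr rfl fun m _ => ?_
      rw [inner_sum]
      refine Finset.sum_congr rfl fun n _ => ?_
      rw [inner_smul_left, inner_smul_right]
      simp [mul_assoc]
    rw [h1, h2] at h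
    linarith
  have hcov : ∀ m (f : H), ∫ ω, inner ℝ (ψ m) (Z ω) * inner ℝ f (Z ω) ∂P
      = lam m * inner ℝ f (ψ m) := by
    intro m f
    simp_rw [mul_comm (inner ℝ (ψ m) _)]
    rw [← inner_secondMomentOp hZ, hE.apply_nonzeroPart, inner_smul_right]
  have hi1 : Integrable (fun ω => 2 * ∑ m ∈ s, inner ℝ (ψ m) (Z ω) * inner ℝ (e m) (Z ω)) P :=
    (integrable_finsetSum _ fun m _ => integrable_inner_mul_inner hZ _ _).const_mul 2
  have hi3 : ∀ m n, Integrable (fun ω =>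
      inner ℝ (ψ m) (Z ω) * inner ℝ (ψ n) (Z ω) * inner ℝ (e m) (e n)) P :=
    fun m n => (integrable_inner_mul_inner hZ _ _).mul_const _
  have hi2 : Integrable (fun ω => ∑ m ∈ s, ∑ n ∈ s,
      inner ℝ (ψ m) (Z ω) * inner ℝ (ψ n) (Z ω) * inner ℝ (e m) (e n)) P :=
    integrable_finsetSum _ fun m _ => integrable_finsetSum _ fun n _ => hi3 m n
  have hmono := integral_mono (hi1.sub hi2) (hY.integrable_norm_pow (by norm_num)) hpt
  have hself : ∀ m, inner ℝ (e m) (ψ m) = ‖e m‖ ^ 2 := by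
    intro m
    rw [← hperp, real_inner_self_eq_norm_sq]
  have hv1 : ∫ ω, 2 * ∑ m ∈ s, inner ℝ (ψ m) (Z ω) * inner ℝ (e m) (Z ω) ∂P
      = 2 * ∑ m ∈ s, lam m * ‖e m‖ ^ 2 := by
    rw [integral_const_mul, integral_finsetSum _ fun m _ => integrable_inner_mul_inner hZ _ _]
    simp_rw [hcov, hself]
  -- Distinct coefficients `⟪ψ m, Z⟫` are uncorrelated, so only the diagonal survives; it is half of
  -- the linear term in `hv1`.
  have hv2 : ∫ ω, ∑ m ∈ s, ∑ n ∈ s,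
      inner ℝ (ψ m) (Z ω) * inner ℝ (ψ n) (Z ω) * inner ℝ (e m) (e n) ∂P
      = ∑ m ∈ s, lam m * ‖e m‖ ^ 2 := by
    rw [integral_finsetSum _ fun m _ => integrable_finsetSum _ fun n _ => hi3 m n]
    refine Finset.sum_congr rfl fun m hm => ?_
    rw [integral_finsetSum _ fun n _ => hi3 m n, Finset.sum_eq_single_of_mem m hm]
    · rw [integral_mul_const, hcov, real_inner_self_eq_norm_sq, real_inner_self_eq_norm_sq,
        hE.mul_norm_nonzeroPart]
    · intro n _ hn
      rw [integral_mul_const, hcov, hE.inner_nonzeroPart_of_ne hn]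
      simp
  have hsub : ∫ ω, (2 * ∑ m ∈ s, inner ℝ (ψ m) (Z ω) * inner ℝ (e m) (Z ω)
      - ∑ m ∈ s, ∑ n ∈ s, inner ℝ (ψ m) (Z ω) * inner ℝ (ψ n) (Z ω) * inner ℝ (e m) (e n)) ∂P
      = ∑ m ∈ s, lam m * ‖e m‖ ^ 2 := by
    rw [integral_sub hi1 hi2, hv1, hv2]
    ring
  rw [← hsub]
  exact hmono

/-- The tail of the eigenvalues of a second moment operator is at most the expected squared
distance to any subspace of dimension at most `K`. -/
theorem tsum_tail_le (hZ : MemLp Z 2 P) (hE : IsEigenSystem (secondMomentOp P Z) lam φ)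
    (G : Submodule ℝ H) [FiniteDimensional ℝ G] {K : ℕ} (hK : Module.finrank ℝ G ≤ K) :
    ∑' m, lam (K + m) ≤ ∫ ω, ‖Z ω - G.starProjection (Z ω)‖ ^ 2 ∂P := by
  refine Real.tsum_le_of_sum_range_le (fun m => hE.nonneg hZ _) fun n => ?_
  have h1 := hE.sum_mul_norm_sub_sq_le hZ G (Finset.range (K + n))
  have h2 : ∀ m, ‖nonzeroPart lam φ m - G.starProjection (nonzeroPart lam φ m)‖ ^ 2
      = ‖nonzeroPart lam φ m‖ ^ 2 - ‖G.starProjection (nonzeroPart lam φ m)‖ ^ 2 := by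
    intro m
    have h := G.starProjection_inner_eq_zero (nonzeroPart lam φ m) _
      (G.starProjection_apply_mem (nonzeroPart lam φ m))
    rw [inner_sub_left, sub_eq_zero, real_inner_self_eq_norm_sq] at h
    rw [norm_sub_sq_real, h]
    ring
  simp_rw [h2, mul_sub, hE.mul_norm_nonzeroPart, Finset.sum_sub_distrib] at h1
  have h3 := sum_mul_le_sum_range_of_antitone hE.antitone (hE.nonneg hZ)
    (w := fun m => ‖G.starProjection (nonzeroPart lam φ m)‖ ^ 2) (fun m => sq_nonneg _)
    (fun m => ?_) (Nat.le_add_right K n)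
    ((hE.sum_norm_starProjection_sq_le _ G).trans (by exact_mod_cast hK))
  · rw [Finset.sum_range_add] at h1
    linarith
  · have h4 := sq_nonneg ‖nonzeroPart lam φ m - G.starProjection (nonzeroPart lam φ m)‖
    rw [h2] at h4
    have h5 := hE.norm_nonzeroPart_le m
    nlinarith [norm_nonneg (nonzeroPart lam φ m)]

variable [IsProbabilityMeasure P]

/-- The operator vanishes on the orthogonal complement, so for each fixed `f` the projection of `Z`
there is almost surely orthogonal to `f`. The null set depends on `f`; separability of the essential
range makes one null set suffice. -/
theorem ae_mem_closure_span (hZ : MemLp Z 2 P)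
    (hE : IsEigenSystem (secondMomentOp P Z) lam φ) :
    ∀ᵐ ω ∂P, Z ω ∈ (Submodule.span ℝ (Set.range (nonzeroPart lam φ))).topologicalClosure := by
  set U := (Submodule.span ℝ (Set.range (nonzeroPart lam φ)))ᗮ with hU
  have hW : AEStronglyMeasurable (fun ω => U.starProjection (Z ω)) P :=
    U.starProjection.continuous.comp_aestronglyMeasurable hZ.1
  obtain ⟨t, ht, htW⟩ := hW.isSeparable_ae_range
  have h0 := ae_eq_zero_of_forall_dual_of_isSeparable ℝ ht (fun c => ?_) htW
  · filter_upwards [h0] with ω hω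
    rw [← Submodule.orthogonal_orthogonal_eq_closure]
    exact U.starProjection_apply_eq_zero_iff.1 hω
  · obtain ⟨f, rfl⟩ := (InnerProductSpace.toDual ℝ H).surjective c
    have hz := hE.apply_eq_zero_of_mem_orthogonal (isCompactOperator_secondMomentOp hZ)
      (isSymmetric_secondMomentOp hZ) (U.starProjection_apply_mem f)
    have h1 := inner_secondMomentOp_self hZ (U.starProjection f)
    rw [hz, inner_zero_right, eq_comm, integral_eq_zero_iff_of_nonneg
      (fun ω => sq_nonneg _) (hZ.const_inner _).integrable_sq] at h1
    filter_upwards [h1] with ω hω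
    rw [InnerProductSpace.toDual_apply_apply, ← U.inner_starProjection_left_eq_right]
    simpa using hω

theorem integral_norm_sq (hZ : MemLp Z 2 P) (hE : IsEigenSystem (secondMomentOp P Z) lam φ) :
    ∫ ω, ‖Z ω‖ ^ 2 ∂P = ∑' m, lam m := by
  have h := integral_tsum_of_summable_integral_norm
    (F := fun m ω => inner ℝ (nonzeroPart lam φ m) (Z ω) ^ 2) (μ := P)
    (fun m => (hZ.const_inner _).integrable_sq) (by
      simpa [hE.integral_inner_sq hZ] using hE.summable hZ)
  simp_rw [hE.integral_inner_sq hZ] at h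
  rw [h]
  refine integral_congr_ae ?_
  filter_upwards [hE.ae_mem_closure_span hZ] with ω hω
  exact (hE.hasSum_inner_sq hω).tsum_eq.symm

/-- The expected squared residual of the projection onto the first `K` principal directions is
at most the tail of the eigenvalues. -/
theorem integral_residual_le (hZ : MemLp Z 2 P)
    (hE : IsEigenSystem (secondMomentOp P Z) lam φ) (K : ℕ) :
    ∫ ω, ‖Z ω - (principalSpan φ K).starProjection (Z ω)‖ ^ 2 ∂P ≤ ∑' m, lam (K + m) := by
  have hi : ∀ m, Integrable (fun ω => inner ℝ (nonzeroPart lam φ m) (Z ω) ^ 2) P :=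
    fun m => (hZ.const_inner _).integrable_sq
  -- The principal span may also contain vectors for the eigenvalue zero, so the partial expansion
  -- serves only as a competitor to the best approximation.
  have hmem : ∀ m ∈ Finset.range K, nonzeroPart lam φ m ∈ principalSpan φ K := by
    intro m hm
    by_cases h : lam m = 0
    · rw [nonzeroPart_of_eq h]; exact zero_mem _
    · rw [nonzeroPart_of_ne h]
      classical
      exact Submodule.subset_span (by simpa using ⟨m, Finset.mem_range.1 hm, rfl⟩)
  have h1 : ∀ ω, ‖Z ω - (principalSpan φ K).starProjection (Z ω)‖ ^ 2
      ≤ ‖Z ω‖ ^ 2 - ∑ m ∈ Finset.range K, inner ℝ (nonzeroPart lam φ m) (Z ω) ^ 2 := by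
    intro ω
    rw [← hE.norm_sub_sum_sq]
    refine pow_le_pow_left₀ (norm_nonneg _) ?_ 2
    exact norm_sub_starProjection_le
      (Submodule.sum_mem _ fun m hm => Submodule.smul_mem _ _ (hmem m hm))
  have hY : MemLp (fun ω => Z ω - (principalSpan φ K).starProjection (Z ω)) 2 P :=
    hZ.sub ((principalSpan φ K).starProjection.comp_memLp' hZ)
  have hn : Integrable (fun ω => ‖Z ω‖ ^ 2) P := hZ.integrable_norm_pow (by norm_num)
  have h2 := integral_mono (hY.integrable_norm_pow (by norm_num))
    (hn.sub (integrable_finsetSum (Finset.range K) fun m _ => hi m)) h1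
  refine h2.trans (le_of_eq ?_)
  have h3 := (hE.summable hZ).sum_add_tsum_nat_add K
  simp only [Pi.sub_apply]
  rw [integral_sub hn (integrable_finsetSum _ fun m _ => hi m),
    integral_finsetSum _ fun m _ => hi m, hE.integral_norm_sq hZ]
  simp_rw [hE.integral_inner_sq hZ, add_comm K]
  linarith

end IsEigenSystem

/-! ### Random fields as random elements of `L²` -/

/-- A map to a second countable metric space is measurable if its distances to all points are. -/
theorem measurable_of_measurable_dist {Ω S : Type*} [MeasurableSpace Ω] [PseudoMetricSpace S]
    [SecondCountableTopology S] [MeasurableSpace S] [BorelSpace S] {f : Ω → S}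
    (h : ∀ g, Measurable fun ω => dist (f ω) g) : Measurable f := by
  refine measurable_of_isOpen fun U hU => ?_
  choose! r hr hrU using Metric.isOpen_iff.1 hU
  obtain ⟨T, hT, hTU⟩ := TopologicalSpace.isOpen_iUnion_countable
    (fun x : U => Metric.ball (x : S) (r x)) fun _ => Metric.isOpen_ball
  have hU' : U = ⋃ x ∈ T, Metric.ball (x : S) (r x) := by
    rw [hTU]
    refine Set.Subset.antisymm (fun x hx => Set.mem_iUnion.2 ⟨⟨x, hx⟩, ?_⟩)
      (Set.iUnion_subset fun x => hrU _ x.2)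
    exact Metric.mem_ball_self (hr x hx)
  rw [hU', Set.preimage_iUnion₂]
  exact MeasurableSet.biUnion hT fun x _ => h _ measurableSet_Iio

section FieldToLp

variable {d : ℕ} {μ : Measure (EuclideanSpace ℝ (Fin d))}
  {v w : EuclideanSpace ℝ (Fin d) → EuclideanSpace ℝ (Fin d)}

theorem fieldToLp_of_memLp (h : MemLp v 2 μ) : fieldToLp μ v = h.toLp v := dif_pos h

theorem fieldToLp_congr (h : v =ᵐ[μ] w) : fieldToLp μ v = fieldToLp μ w := by
  unfold fieldToLp
  by_cases hv : MemLp v 2 μ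
  · have hw : MemLp w 2 μ := (memLp_congr_ae h).1 hv
    rw [dif_pos hv, dif_pos hw, MemLp.toLp_eq_toLp_iff]
    exact h
  · have hw : ¬ MemLp w 2 μ := fun hw => hv ((memLp_congr_ae h).2 hw)
    rw [dif_neg hv, dif_neg hw]

theorem norm_fieldToLp_sq (h : MemLp v 2 μ) : ‖fieldToLp μ v‖ ^ 2 = ∫ x, ‖v x‖ ^ 2 ∂μ := by
  rw [fieldToLp_of_memLp h, ← real_inner_self_eq_norm_sq, L2.inner_def]
  refine integral_congr_ae ?_
  filter_upwards [h.coeFn_toLp] with x hx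
  rw [hx, real_inner_self_eq_norm_sq]

theorem fieldToLp_sub (hv : MemLp v 2 μ) (hw : MemLp w 2 μ) :
    fieldToLp μ v - fieldToLp μ w = fieldToLp μ (v - w) := by
  rw [fieldToLp_of_memLp hv, fieldToLp_of_memLp hw, fieldToLp_of_memLp (hv.sub hw),
    MemLp.toLp_sub]

variable {Ω : Type*} [MeasurableSpace Ω] {P : Measure Ω} [IsProbabilityMeasure μ]
  {V W : Ω → EuclideanSpace ℝ (Fin d) → EuclideanSpace ℝ (Fin d)}

/-- As `L²` is separable, only distances to fixed elements `g` matter, and these are parametric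
integrals of jointly measurable functions. -/
theorem measurable_fieldToLp (hV : StronglyMeasurable (Function.uncurry V)) :
    @Measurable _ _ _ (borel _) fun ω => fieldToLp μ (V ω) := by
  borelize (FieldSpace μ)
  have : Fact ((2 : ENNReal) ≠ ⊤) := ⟨by norm_num⟩
  refine measurable_of_measurable_dist fun g => ?_
  have hVω : ∀ ω, StronglyMeasurable (V ω) := fun ω => hV.comp_measurable measurable_prodMk_left
  have hmeas : ∀ u : EuclideanSpace ℝ (Fin d) → EuclideanSpace ℝ (Fin d), StronglyMeasurable u →
      Measurable fun ω => eLpNorm (V ω - u) 2 μ := by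
    intro u hu
    simp_rw [eLpNorm_eq_lintegral_rpow_enorm_toReal two_ne_zero ENNReal.ofNat_ne_top]
    have h1 : StronglyMeasurable fun p : Ω × EuclideanSpace ℝ (Fin d) => V p.1 p.2 - u p.2 :=
      hV.sub (hu.comp_measurable measurable_snd)
    have h2 := (h1.enorm.pow_const (2 : ENNReal).toReal).lintegral_prod_right' (ν := μ)
    exact h2.pow_const _
  let S : Set Ω := {ω | eLpNorm (V ω - 0) 2 μ < ⊤}
  have hS : MeasurableSet S :=
    hmeas 0 stronglyMeasurable_zero measurableSet_Iio
  classical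
  -- Off `S` the sample is not square-integrable and `fieldToLp` takes its default value `0`.
  have hdist : (fun ω => dist (fieldToLp μ (V ω)) g) =
      S.piecewise (fun ω => (eLpNorm (V ω - ⇑g) 2 μ).toReal) fun _ => dist 0 g := by
    funext ω
    by_cases h : ω ∈ S
    · rw [Set.piecewise_eq_of_mem _ _ _ h]
      change eLpNorm (V ω - 0) 2 μ < ⊤ at h
      rw [sub_zero] at h
      have hm : MemLp (V ω) 2 μ := ⟨(hVω ω).aestronglyMeasurable, h⟩
      rw [fieldToLp_of_memLp hm, Lp.dist_def]
      congr 1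
      refine eLpNorm_congr_ae ?_
      filter_upwards [hm.coeFn_toLp] with x hx
      simp [hx]
    · rw [Set.piecewise_eq_of_notMem _ _ _ h]
      change ¬ eLpNorm (V ω - 0) 2 μ < ⊤ at h
      rw [sub_zero] at h
      rw [fieldToLp, dif_neg fun hm : MemLp (V ω) 2 μ => h hm.2]
  rw [hdist]
  exact ((hmeas g (Lp.stronglyMeasurable g)).ennreal_toReal).piecewise hS measurable_const

theorem aestronglyMeasurable_fieldToLp
    (hV : AEStronglyMeasurable (Function.uncurry V) (P.prod μ)) :
    AEStronglyMeasurable (fun ω => fieldToLp μ (V ω)) P := by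
  borelize (FieldSpace μ)
  have : Fact ((2 : ENNReal) ≠ ⊤) := ⟨by norm_num⟩
  obtain ⟨W, hW, hVW⟩ := hV
  have h : Measurable fun ω => fieldToLp μ fun x => W (ω, x) := measurable_fieldToLp hW
  refine ⟨_, h.stronglyMeasurable, ?_⟩
  filter_upwards [Measure.ae_ae_of_ae_prod hVW] with ω hω
  exact fieldToLp_congr hω

variable [IsProbabilityMeasure P]

theorem ae_memLp_of_memLp_prod (hV : MemLp (Function.uncurry V) 2 (P.prod μ)) :
    ∀ᵐ ω ∂P, MemLp (V ω) 2 μ := by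
  have h := (hV.integrable_norm_pow (by norm_num)).prod_right_ae
  filter_upwards [h, hV.1.prodMk_left] with ω h1 h2
  exact (memLp_two_iff_integrable_sq_norm h2).2 h1

theorem norm_fieldToLp_sq_ae_eq (hV : MemLp (Function.uncurry V) 2 (P.prod μ)) :
    (fun ω => ‖fieldToLp μ (V ω)‖ ^ 2) =ᵐ[P] fun ω => ∫ x, ‖V ω x‖ ^ 2 ∂μ := by
  filter_upwards [ae_memLp_of_memLp_prod hV] with ω hω using norm_fieldToLp_sq hω

/-- A square-integrable random field is a square-integrable random element of `H`. -/
theorem memLp_fieldToLp (hV : MemLp (Function.uncurry V) 2 (P.prod μ)) :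
    MemLp (fun ω => fieldToLp μ (V ω)) 2 P := by
  rw [memLp_two_iff_integrable_sq_norm (aestronglyMeasurable_fieldToLp hV.1),
    integrable_congr (norm_fieldToLp_sq_ae_eq hV)]
  exact (hV.integrable_norm_pow (by norm_num)).integral_prod_left

theorem integral_norm_fieldToLp_sq (hV : MemLp (Function.uncurry V) 2 (P.prod μ)) :
    ∫ ω, ‖fieldToLp μ (V ω)‖ ^ 2 ∂P = ∫ x, ∫ ω, ‖V ω x‖ ^ 2 ∂P ∂μ := by
  rw [integral_congr_ae (norm_fieldToLp_sq_ae_eq hV)]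
  exact integral_integral_swap (hV.integrable_norm_pow (by norm_num))

/-- A field with uniformly bounded second moments is square-integrable. -/
theorem memLp_prod_of_integral_le (hV : AEStronglyMeasurable (Function.uncurry V) (P.prod μ))
    {B : ℝ} (hi : ∀ᵐ x ∂μ, MemLp (fun ω => V ω x) 2 P)
    (hB : ∀ᵐ x ∂μ, ∫ ω, ‖V ω x‖ ^ 2 ∂P ≤ B) :
    MemLp (Function.uncurry V) 2 (P.prod μ) := by
  rw [memLp_two_iff_integrable_sq_norm hV]
  have hm : AEStronglyMeasurable (fun p => ‖Function.uncurry V p‖ ^ 2) (P.prod μ) := hV.norm.pow 2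
  rw [integrable_prod_iff' hm]
  refine ⟨?_, ?_⟩
  · filter_upwards [hi] with x hx using hx.integrable_norm_pow (by norm_num)
  · refine Integrable.of_bound (C := B) hm.norm.prod_swap.integral_prod_right' ?_
    filter_upwards [hB] with x hx
    have h0 : 0 ≤ ∫ ω, ‖V ω x‖ ^ 2 ∂P := integral_nonneg fun ω => sq_nonneg _
    simpa [abs_of_nonneg h0] using hx

end FieldToLp

/-! ### Piecewise constant fields -/

section PiecewiseConstant

variable {d : ℕ} {μ : Measure (EuclideanSpace ℝ (Fin d))} [IsProbabilityMeasure μ]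
  {ι : Type*} [Fintype ι] [MeasurableSpace ι] [MeasurableSingletonClass ι]
  {c : EuclideanSpace ℝ (Fin d) → ι}

theorem memLp_comp_of_finite (hc : Measurable c) (u : ι → EuclideanSpace ℝ (Fin d)) :
    MemLp (fun x => u (c x)) 2 μ :=
  MemLp.of_bound ((measurable_of_finite u).comp hc).aestronglyMeasurable ‖u‖
    (Filter.Eventually.of_forall fun x => norm_le_pi_norm u (c x))

/-- The fields that are constant on the fibres of `c`, as elements of `H`. -/
def fibrewiseConst (μ : Measure (EuclideanSpace ℝ (Fin d))) [IsProbabilityMeasure μ]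
    (hc : Measurable c) : Submodule ℝ (FieldSpace μ) :=
  LinearMap.range
    ({ toFun := fun u => (memLp_comp_of_finite hc u).toLp
       map_add' := fun _ _ => rfl
       map_smul' := fun _ _ => rfl } : (ι → EuclideanSpace ℝ (Fin d)) →ₗ[ℝ] FieldSpace μ)

instance (hc : Measurable c) : FiniteDimensional ℝ (fibrewiseConst μ hc) := by
  unfold fibrewiseConst
  infer_instance

theorem finrank_fibrewiseConst_le (hc : Measurable c) :
    Module.finrank ℝ (fibrewiseConst μ hc) ≤ Fintype.card ι * d := by
  refine (LinearMap.finrank_range_le _).trans (le_of_eq ?_)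
  rw [Module.finrank_pi_fintype]
  simp

theorem fieldToLp_comp_mem_fibrewiseConst (hc : Measurable c)
    (u : ι → EuclideanSpace ℝ (Fin d)) :
    fieldToLp μ (fun x => u (c x)) ∈ fibrewiseConst μ hc := by
  rw [fieldToLp_of_memLp (memLp_comp_of_finite hc u)]
  exact ⟨u, rfl⟩

end PiecewiseConstant

/-! ### Frobenius norm estimates -/

section Frobenius

open scoped Matrix.Norms.Frobenius

variable {d : ℕ}

theorem frobenius_norm_sq (M : Matrix (Fin d) (Fin d) ℝ) :
    ‖M‖ ^ 2 = ∑ i, ∑ j, M i j ^ 2 := by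
  have h0 : 0 ≤ ∑ i, ∑ j, M i j ^ 2 :=
    Finset.sum_nonneg fun i _ => Finset.sum_nonneg fun j _ => sq_nonneg _
  rw [Matrix.frobenius_norm_def]
  simp only [Real.rpow_ofNat, Real.norm_eq_abs, sq_abs]
  rw [← Real.sqrt_eq_rpow, Real.sq_sqrt h0]

/-- Cauchy–Schwarz against the identity matrix, whose Frobenius norm is `√d`. -/
theorem abs_sum_diag_le (M : Matrix (Fin d) (Fin d) ℝ) : |∑ i, M i i| ≤ √d * ‖M‖ := by
  refine abs_le_of_sq_le_sq ?_ (by positivity)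
  rw [mul_pow, Real.sq_sqrt (Nat.cast_nonneg d), frobenius_norm_sq]
  have h1 := sq_sum_le_card_mul_sum_sq (s := Finset.univ) (f := fun i => M i i)
  rw [Finset.card_univ, Fintype.card_fin] at h1
  refine h1.trans (mul_le_mul_of_nonneg_left ?_ (Nat.cast_nonneg d))
  exact Finset.sum_le_sum fun i _ =>
    Finset.single_le_sum (f := fun j => M i j ^ 2) (fun j _ => sq_nonneg _) (Finset.mem_univ i)

theorem sum_mul_mul_le (M : Matrix (Fin d) (Fin d) ℝ) (u v : EuclideanSpace ℝ (Fin d)) :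
    ∑ i, ∑ j, M i j * (u i * v j) ≤ ‖M‖ * (‖u‖ * ‖v‖) := by
  refine le_of_abs_le (abs_le_of_sq_le_sq ?_ (by positivity))
  rw [mul_pow, mul_pow, frobenius_norm_sq, EuclideanSpace.real_norm_sq_eq,
    EuclideanSpace.real_norm_sq_eq, Finset.sum_mul_sum]
  simp_rw [← mul_pow, ← Finset.sum_product']
  exact Finset.sum_mul_sq_le_sq_mul_sq _ _ _

variable {Ω : Type*} [MeasurableSpace Ω] {P : Measure Ω}

theorem integrable_coord_mul_coord {u v : Ω → EuclideanSpace ℝ (Fin d)} (hu : MemLp u 2 P)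
    (hv : MemLp v 2 P) (i j : Fin d) : Integrable (fun ω => u ω i * v ω j) P :=
  ((EuclideanSpace.proj (𝕜 := ℝ) i).comp_memLp' hu).integrable_mul
    ((EuclideanSpace.proj (𝕜 := ℝ) j).comp_memLp' hv)

/-- Pair `M` with itself: `‖M‖²` is the mean of the inner product of `M` with `u vᵀ`, hence at most
`‖M‖ * E[‖u‖ ‖v‖]`; then cancel `‖M‖`. -/
theorem frobenius_norm_integral_le {u v : Ω → EuclideanSpace ℝ (Fin d)} (hu : MemLp u 2 P)
    (hv : MemLp v 2 P) :
    ‖(Matrix.of fun i j => ∫ ω, u ω i * v ω j ∂P : Matrix (Fin d) (Fin d) ℝ)‖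
      ≤ ∫ ω, ‖u ω‖ * ‖v ω‖ ∂P := by
  set M : Matrix (Fin d) (Fin d) ℝ := Matrix.of fun i j => ∫ ω, u ω i * v ω j ∂P with hM
  have hi : ∀ i j, Integrable (fun ω => M i j * (u ω i * v ω j)) P :=
    fun i j => (integrable_coord_mul_coord hu hv i j).const_mul _
  have h1 : ‖M‖ ^ 2 = ∫ ω, ∑ i, ∑ j, M i j * (u ω i * v ω j) ∂P := by
    rw [frobenius_norm_sq, integral_finsetSum _ fun i _ => integrable_finsetSum _ fun j _ => hi i j]
    refine Finset.sum_congr rfl fun i _ => ?_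
    rw [integral_finsetSum _ fun j _ => hi i j]
    refine Finset.sum_congr rfl fun j _ => ?_
    rw [integral_const_mul, sq]
    rfl
  have h2 : ‖M‖ ^ 2 ≤ ‖M‖ * ∫ ω, ‖u ω‖ * ‖v ω‖ ∂P := by
    rw [h1, ← integral_const_mul]
    exact integral_mono (integrable_finsetSum _ fun i _ => integrable_finsetSum _ fun j _ => hi i j)
      ((hu.norm.integrable_mul hv.norm).const_mul _) fun ω => sum_mul_mul_le M _ _
  have h3 : 0 ≤ ∫ ω, ‖u ω‖ * ‖v ω‖ ∂P := integral_nonneg fun ω => by positivity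
  rcases (norm_nonneg M).eq_or_lt with h | h
  · rw [← h]; exact h3
  · nlinarith

end Frobenius

/-! ### Lipschitz kernels and mean-square continuity -/

section Kernel

variable {d : ℕ} {Ω : Type*} [MeasurableSpace Ω] {P : Measure Ω}
  {X : Set (EuclideanSpace ℝ (Fin d))}
  {V : Ω → EuclideanSpace ℝ (Fin d) → EuclideanSpace ℝ (Fin d)}

theorem integral_norm_le_of_integral_sq_le [IsProbabilityMeasure P] {E : Type*}
    [NormedAddCommGroup E] {f : Ω → E} (hf : MemLp f 2 P) {B : ℝ} (hB : 0 ≤ B)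
    (h : ∫ ω, ‖f ω‖ ^ 2 ∂P ≤ B ^ 2) :
    ∫ ω, ‖f ω‖ ∂P ≤ B := by
  refine le_of_abs_le (abs_le_of_sq_le_sq ?_ hB)
  have h1 := ProbabilityTheory.variance_nonneg (fun ω => ‖f ω‖) P
  rw [ProbabilityTheory.variance_eq_sub hf.norm] at h1
  simp only [Pi.pow_apply] at h1
  linarith

open scoped Matrix.Norms.Frobenius in
/-- A field with Lipschitz sample paths has a Lipschitz covariance kernel. -/
theorem kernelLipschitzOn_of_lipschitzOnWith [IsProbabilityMeasure P]
    (hV : ∀ x ∈ X, MemLp (fun ω => V ω x) 2 P)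
    {L : NNReal} {B : ℝ} (hB : 0 ≤ B) (hL : ∀ᵐ ω ∂P, LipschitzOnWith L (V ω) X)
    (hVB : ∀ z ∈ X, ∫ ω, ‖V ω z‖ ^ 2 ∂P ≤ B ^ 2) :
    KernelLipschitzOn X (covKernel P V) (L * B) := by
  intro x hx y hy x' hx' y' hy'
  have hb : ∀ a ∈ X, ∀ b ∈ X, ∀ z ∈ X,
      ∫ ω, ‖V ω a - V ω b‖ * ‖V ω z‖ ∂P ≤ L * B * ‖a - b‖ := by
    intro a ha b hb z hz
    have h1 : ∫ ω, ‖V ω a - V ω b‖ * ‖V ω z‖ ∂P ≤ ∫ ω, L * ‖a - b‖ * ‖V ω z‖ ∂P := by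
      refine integral_mono_ae (((hV a ha).sub (hV b hb)).norm.integrable_mul (hV z hz).norm)
        (((hV z hz).norm.integrable one_le_two).const_mul _) ?_
      filter_upwards [hL] with ω hω
      exact mul_le_mul_of_nonneg_right (hω.norm_sub_le ha hb) (norm_nonneg _)
    rw [integral_const_mul] at h1
    refine h1.trans ?_
    have h2 := integral_norm_le_of_integral_sq_le (hV z hz) hB (hVB z hz)
    calc L * ‖a - b‖ * ∫ ω, ‖V ω z‖ ∂P ≤ L * ‖a - b‖ * B := by gcongr
      _ = L * B * ‖a - b‖ := by ring
  -- Change one argument of the kernel at a time.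
  have hdec : covKernel P V x y - covKernel P V x' y'
      = (Matrix.of fun i j => ∫ ω, (V ω x - V ω x') i * V ω y j ∂P)
        + Matrix.of fun i j => ∫ ω, V ω x' i * (V ω y - V ω y') j ∂P := by
    ext i j
    have hi := fun a ha b hb => integrable_coord_mul_coord (hV a ha) (hV b hb) i j
    simp only [covKernel, Matrix.sub_apply, Matrix.add_apply, Matrix.of_apply, PiLp.sub_apply,
      sub_mul, mul_sub]
    rw [integral_sub (hi x hx y hy) (hi x' hx' y hy), integral_sub (hi x' hx' y hy)
      (hi x' hx' y' hy')]
    ring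
  rw [hdec]
  have h1 := frobenius_norm_integral_le ((hV x hx).sub (hV x' hx')) (hV y hy)
  have h2 := frobenius_norm_integral_le (hV x' hx') ((hV y hy).sub (hV y' hy'))
  have h3 := hb x hx x' hx' y hy
  have h4 := hb y hy y' hy' x' hx'
  simp only [Pi.sub_apply] at h1 h2
  rw [show (fun ω => ‖V ω x'‖ * ‖V ω y - V ω y'‖) = fun ω => ‖V ω y - V ω y'‖ * ‖V ω x'‖ from
    funext fun ω => mul_comm _ _] at h2
  refine (norm_add_le _ _).trans ?_
  rw [mul_add]
  exact add_le_add (h1.trans h3) (h2.trans h4)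

/-- If the covariance kernel is Lipschitz, then the field is `1/2`-Hölder in mean square. -/
theorem KernelLipschitzOn.integral_norm_sub_sq_le {C : ℝ}
    (hK : KernelLipschitzOn X (covKernel P V) C) (hV : ∀ x ∈ X, MemLp (fun ω => V ω x) 2 P)
    {x y : EuclideanSpace ℝ (Fin d)} (hx : x ∈ X) (hy : y ∈ X) :
    ∫ ω, ‖V ω x - V ω y‖ ^ 2 ∂P ≤ 2 * √d * C * ‖x - y‖ := by
  have hi := fun a ha b hb i => integrable_coord_mul_coord (hV a ha) (hV b hb) i i
  -- Expanding the square gives four traces, grouped so that each difference moves only one argument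
  -- of the kernel.
  have h1 : ∫ ω, ‖V ω x - V ω y‖ ^ 2 ∂P
      = ∑ i, (covKernel P V x x - covKernel P V x y) i i
        + ∑ i, (covKernel P V y y - covKernel P V y x) i i := by
    have hi' : ∀ i, Integrable (fun ω => (V ω x i * V ω x i - V ω x i * V ω y i)
        + (V ω y i * V ω y i - V ω y i * V ω x i)) P := fun i =>
      ((hi x hx x hx i).sub (hi x hx y hy i)).add ((hi y hy y hy i).sub (hi y hy x hx i))
    have h2 : ∀ ω, ‖V ω x - V ω y‖ ^ 2 = ∑ i, ((V ω x i * V ω x i - V ω x i * V ω y i)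
        + (V ω y i * V ω y i - V ω y i * V ω x i)) := by
      intro ω
      rw [EuclideanSpace.real_norm_sq_eq]
      refine Finset.sum_congr rfl fun i _ => ?_
      rw [PiLp.sub_apply]
      ring
    simp_rw [h2]
    rw [integral_finsetSum _ fun i _ => hi' i, ← Finset.sum_add_distrib]
    refine Finset.sum_congr rfl fun i _ => ?_
    have ha : Integrable (fun ω => V ω x i * V ω x i - V ω x i * V ω y i) P :=
      (hi x hx x hx i).sub (hi x hx y hy i)
    have hb : Integrable (fun ω => V ω y i * V ω y i - V ω y i * V ω x i) P :=
      (hi y hy y hy i).sub (hi y hy x hx i)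
    rw [integral_add ha hb, integral_sub (hi x hx x hx i) (hi x hx y hy i),
      integral_sub (hi y hy y hy i) (hi y hy x hx i)]
    rfl
  have h3 := (le_abs_self _).trans (abs_sum_diag_le (covKernel P V x x - covKernel P V x y))
  have h4 := (le_abs_self _).trans (abs_sum_diag_le (covKernel P V y y - covKernel P V y x))
  have h5 := mul_le_mul_of_nonneg_left (hK x hx x hx x hx y hy) (Real.sqrt_nonneg d)
  have h6 := mul_le_mul_of_nonneg_left (hK y hy y hy y hy x hx) (Real.sqrt_nonneg d)
  rw [sub_self, norm_zero, zero_add] at h5 h6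
  rw [norm_sub_rev y x] at h6
  rw [h1]
  linarith

/-- Comparison with one fixed point of the bounded set. The uniform bound yields
square-integrability on the product space. -/
theorem KernelLipschitzOn.exists_integral_norm_sq_le {C : ℝ} (hC : 0 ≤ C)
    (hK : KernelLipschitzOn X (covKernel P V) C) (hV : ∀ x ∈ X, MemLp (fun ω => V ω x) 2 P)
    (hX : Bornology.IsBounded X) :
    ∃ B : ℝ, ∀ x ∈ X, ∫ ω, ‖V ω x‖ ^ 2 ∂P ≤ B := by
  rcases X.eq_empty_or_nonempty with rfl | ⟨x₀, hx₀⟩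
  · exact ⟨0, by simp⟩
  refine ⟨2 * (2 * √d * C * Metric.diam X) + 2 * ∫ ω, ‖V ω x₀‖ ^ 2 ∂P, fun x hx => ?_⟩
  have hi1 : Integrable (fun ω => ‖V ω x - V ω x₀‖ ^ 2) P :=
    ((hV x hx).sub (hV x₀ hx₀)).integrable_norm_pow (by norm_num)
  have hi2 : Integrable (fun ω => ‖V ω x₀‖ ^ 2) P :=
    (hV x₀ hx₀).integrable_norm_pow (by norm_num)
  have h1 : ∫ ω, ‖V ω x‖ ^ 2 ∂P
      ≤ ∫ ω, (2 * ‖V ω x - V ω x₀‖ ^ 2 + 2 * ‖V ω x₀‖ ^ 2) ∂P := by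
    refine integral_mono ((hV x hx).integrable_norm_pow (by norm_num))
      ((hi1.const_mul 2).add (hi2.const_mul 2)) fun ω => ?_
    have h2 : ‖V ω x‖ ≤ ‖V ω x - V ω x₀‖ + ‖V ω x₀‖ := by
      simpa using norm_add_le (V ω x - V ω x₀) (V ω x₀)
    have h3 := norm_nonneg (V ω x)
    have h4 := sq_nonneg (‖V ω x - V ω x₀‖ - ‖V ω x₀‖)
    change ‖V ω x‖ ^ 2 ≤ 2 * ‖V ω x - V ω x₀‖ ^ 2 + 2 * ‖V ω x₀‖ ^ 2
    nlinarith
  rw [integral_add (hi1.const_mul 2) (hi2.const_mul 2), integral_const_mul,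
    integral_const_mul] at h1
  have h2 := hK.integral_norm_sub_sq_le hV hx hx₀
  have h3 : 2 * √d * C * ‖x - x₀‖ ≤ 2 * √d * C * Metric.diam X := by
    rw [← dist_eq_norm]
    exact mul_le_mul_of_nonneg_left (Metric.dist_le_diam_of_mem hX hx hx₀) (by positivity)
  linarith

end Kernel

/-! ### The grid -/

/-- A bounded subset of `ℝᵈ` is divided into `n ^ d` cells of diameter at most
`2 √d diam X / n`. -/
theorem exists_measurable_partition {d : ℕ} {X : Set (EuclideanSpace ℝ (Fin d))}
    (hX : Bornology.IsBounded X) {n : ℕ} (hn : 0 < n) :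
    ∃ c : EuclideanSpace ℝ (Fin d) → Fin d → Fin n, Measurable c ∧
      ∀ x ∈ X, ∀ y ∈ X, c x = c y → dist x y ≤ √d * (2 * Metric.diam X / n) := by
  have hn' : (0 : ℝ) < n := Nat.cast_pos.2 hn
  rcases X.eq_empty_or_nonempty with rfl | ⟨x₀, hx₀⟩
  · exact ⟨fun _ _ => ⟨0, hn⟩, measurable_const, by simp⟩
  set D := Metric.diam X with hD
  rcases (Metric.diam_nonneg (s := X)).eq_or_lt with hD0 | (hD0 : 0 < D)
  · refine ⟨fun _ _ => ⟨0, hn⟩, measurable_const, fun x hx y hy _ => ?_⟩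
    have := Metric.dist_le_diam_of_mem hX hx hy
    rw [← hD0] at this
    exact this.trans (by positivity)
  -- The cube of side `2 * D` centred at `x₀` contains `X`; it is rescaled to `[0, n] ^ d`. The
  -- minimum in `f` puts the upper face `r = n` into the last cell.
  let t : EuclideanSpace ℝ (Fin d) → Fin d → ℝ := fun x i => (x i - x₀ i + D) * (n / (2 * D))
  let f : ℝ → Fin n := fun r => ⟨min ⌊r⌋₊ (n - 1), by omega⟩
  have ht : ∀ x ∈ X, ∀ i, 0 ≤ t x i ∧ t x i ≤ n := by
    intro x hx i
    have h1 : |x i - x₀ i| ≤ D := by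
      have h2 := PiLp.norm_apply_le (x - x₀) i
      rw [← dist_eq_norm] at h2
      exact h2.trans (Metric.dist_le_diam_of_mem hX hx hx₀)
    obtain ⟨h2, h3⟩ := abs_le.1 h1
    refine ⟨mul_nonneg (by linarith) (by positivity), ?_⟩
    calc t x i ≤ (2 * D) * (n / (2 * D)) :=
          mul_le_mul_of_nonneg_right (by linarith) (by positivity)
      _ = n := by field_simp
  have hf : ∀ r : ℝ, 0 ≤ r → r ≤ n → ((f r : ℕ) : ℝ) ≤ r ∧ r ≤ (f r : ℕ) + 1 := by
    intro r hr0 hrn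
    have h1 := Nat.floor_le hr0
    have h2 := Nat.lt_floor_add_one r
    have h4 : ((n - 1 : ℕ) : ℝ) = n - 1 := by rw [Nat.cast_sub hn]; simp
    change ((min ⌊r⌋₊ (n - 1) : ℕ) : ℝ) ≤ r ∧ r ≤ (min ⌊r⌋₊ (n - 1) : ℕ) + 1
    rw [Nat.cast_min, h4]
    refine ⟨(min_le_left _ _).trans h1, ?_⟩
    rw [← sub_le_iff_le_add, le_min_iff]
    exact ⟨by linarith, by linarith⟩
  have hfm : Measurable f :=
    (measurable_of_countable (fun k : ℕ => (⟨min k (n - 1), by omega⟩ : Fin n))).comp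
      Nat.measurable_floor
  refine ⟨fun x i => f (t x i), ?_, fun x hx y hy hxy => ?_⟩
  · refine measurable_pi_lambda _ fun i => hfm.comp ?_
    exact (Continuous.measurable (by fun_prop))
  · have hi : ∀ i, (x i - y i) ^ 2 ≤ (2 * D / n) ^ 2 := by
      intro i
      have h1 := hf _ (ht x hx i).1 (ht x hx i).2
      have h2 := hf _ (ht y hy i).1 (ht y hy i).2
      rw [show f (t x i) = f (t y i) from congrFun hxy i] at h1
      have h3 : x i - y i = (t x i - t y i) * (2 * D / n) := by
        simp only [t]; field_simp; ring
      rw [h3, mul_pow]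
      have h4 : (t x i - t y i) ^ 2 ≤ 1 := by
        rw [sq_le_one_iff_abs_le_one, abs_le]
        exact ⟨by linarith, by linarith⟩
      exact mul_le_of_le_one_left (sq_nonneg _) h4
    refine le_of_abs_le (abs_le_of_sq_le_sq ?_ (by positivity))
    rw [dist_eq_norm, EuclideanSpace.real_norm_sq_eq, mul_pow, Real.sq_sqrt (Nat.cast_nonneg d)]
    calc ∑ i, (x - y) i ^ 2 ≤ ∑ _i : Fin d, (2 * D / n) ^ 2 := Finset.sum_le_sum fun i _ => hi i
      _ = d * (2 * D / n) ^ 2 := by simp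

/-! ### Approximation by grid fields and the tail bound -/

section Field

variable {d : ℕ} {Ω : Type*} [MeasurableSpace Ω] {P : Measure Ω} [IsProbabilityMeasure P]
  {X : Set (EuclideanSpace ℝ (Fin d))} {μ : Measure (EuclideanSpace ℝ (Fin d))}
  [IsProbabilityMeasure μ]
  {V : Ω → EuclideanSpace ℝ (Fin d) → EuclideanSpace ℝ (Fin d)} {C : ℝ}

theorem KernelLipschitzOn.memLp_prod (hC : 0 ≤ C) (hK : KernelLipschitzOn X (covKernel P V) C)
    (hX : Bornology.IsBounded X) (hμ : ∀ᵐ x ∂μ, x ∈ X)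
    (hVm : AEStronglyMeasurable (Function.uncurry V) (P.prod μ))
    (hV : ∀ x ∈ X, MemLp (fun ω => V ω x) 2 P) :
    MemLp (Function.uncurry V) 2 (P.prod μ) := by
  obtain ⟨B, hB⟩ := hK.exists_integral_norm_sq_le hC hV hX
  refine memLp_prod_of_integral_le (B := B) hVm ?_ ?_
  · filter_upwards [hμ] with x hx using hV x hx
  · filter_upwards [hμ] with x hx using hB x hx

/-- A finite measurable partition with cells of diameter at most `δ` on `X` gives a
finite-dimensional subspace that is close to the field in mean square. -/
theorem KernelLipschitzOn.integral_norm_sub_fibrewiseConst_le {ι : Type*} [Fintype ι]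
    [MeasurableSpace ι] [MeasurableSingletonClass ι] {c : EuclideanSpace ℝ (Fin d) → ι}
    (hC : 0 ≤ C) (hK : KernelLipschitzOn X (covKernel P V) C)
    (hX : Bornology.IsBounded X) (hμ : ∀ᵐ x ∂μ, x ∈ X)
    (hVm : AEStronglyMeasurable (Function.uncurry V) (P.prod μ))
    (hV : ∀ x ∈ X, MemLp (fun ω => V ω x) 2 P) (hc : Measurable c) {δ : ℝ}
    (hδ : ∀ x ∈ X, ∀ y ∈ X, c x = c y → dist x y ≤ δ) :
    ∫ ω, ‖fieldToLp μ (V ω) - (fibrewiseConst μ hc).starProjection (fieldToLp μ (V ω))‖ ^ 2 ∂P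
      ≤ 2 * √d * C * δ := by
  classical
  obtain ⟨x₀, hx₀⟩ := hμ.exists
  -- A representative in `X` of each cell; a cell missing `X` gets `x₀`, so that moment bounds hold
  -- at every `s k`.
  let s : ι → EuclideanSpace ℝ (Fin d) := fun k => if h : ∃ x ∈ X, c x = k then h.choose else x₀
  have hsX : ∀ k, s k ∈ X := by
    intro k
    by_cases h : ∃ x ∈ X, c x = k
    · simp only [s, dif_pos h]; exact h.choose_spec.1
    · simp only [s, dif_neg h]; exact hx₀
  have hsc : ∀ x ∈ X, c (s (c x)) = c x := by
    intro x hx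
    have h : ∃ y ∈ X, c y = c x := ⟨x, hx, rfl⟩
    simp only [s, dif_pos h]
    exact h.choose_spec.2
  let W : Ω → EuclideanSpace ℝ (Fin d) → EuclideanSpace ℝ (Fin d) := fun ω x => V ω (s (c x))
  have hVp := hK.memLp_prod hC hX hμ hVm hV
  -- Since `c` has finitely many values, `W` is a finite sum of fixed-point evaluations of `V` cut
  -- off to cells.
  have hWm : AEStronglyMeasurable (Function.uncurry W) (P.prod μ) := by
    have h1 : Function.uncurry W = fun p : Ω × EuclideanSpace ℝ (Fin d) =>
        ∑ k, (Prod.snd ⁻¹' (c ⁻¹' {k})).indicator (fun p => V p.1 (s k)) p := by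
      funext p
      rw [Finset.sum_eq_single (c p.2)]
      · have h : p ∈ Prod.snd ⁻¹' (c ⁻¹' {c p.2}) := by simp
        rw [Set.indicator_of_mem h]
        rfl
      · intro k _ hk
        have h : p ∉ Prod.snd ⁻¹' (c ⁻¹' {k}) := by simpa using hk.symm
        exact Set.indicator_of_notMem h _
      · simp
    rw [h1]
    refine Finset.aestronglyMeasurable_fun_sum _ fun k _ => ?_
    exact ((hV _ (hsX k)).1.comp_fst).indicator
      (measurable_snd (hc (measurableSet_singleton k)))
  obtain ⟨B, hB⟩ := hK.exists_integral_norm_sq_le hC hV hX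
  have hWp : MemLp (Function.uncurry W) 2 (P.prod μ) :=
    memLp_prod_of_integral_le (B := B) hWm
      (Filter.Eventually.of_forall fun x => hV _ (hsX _))
      (Filter.Eventually.of_forall fun x => hB _ (hsX _))
  have hD : MemLp (Function.uncurry fun ω => V ω - W ω) 2 (P.prod μ) := hVp.sub hWp
  have hZ := memLp_fieldToLp hVp
  have h1 : ∫ ω, ‖fieldToLp μ (V ω) - (fibrewiseConst μ hc).starProjection (fieldToLp μ (V ω))‖ ^ 2
      ∂P ≤ ∫ ω, ‖fieldToLp μ (V ω - W ω)‖ ^ 2 ∂P := by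
    refine integral_mono_ae
      ((hZ.sub ((fibrewiseConst μ hc).starProjection.comp_memLp' hZ)).integrable_norm_pow
        (by norm_num)) ((memLp_fieldToLp hD).integrable_norm_pow (by norm_num)) ?_
    filter_upwards [ae_memLp_of_memLp_prod hVp] with ω hω
    refine pow_le_pow_left₀ (norm_nonneg _) ?_ 2
    rw [← fieldToLp_sub hω (memLp_comp_of_finite hc fun k => V ω (s k))]
    exact norm_sub_starProjection_le (fieldToLp_comp_mem_fibrewiseConst hc fun k => V ω (s k))
  refine h1.trans ?_
  rw [integral_norm_fieldToLp_sq hD]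
  have h2 : ∀ᵐ x ∂μ, ∫ ω, ‖(V ω - W ω) x‖ ^ 2 ∂P ≤ 2 * √d * C * δ := by
    filter_upwards [hμ] with x hx
    refine (hK.integral_norm_sub_sq_le hV hx (hsX (c x))).trans ?_
    rw [← dist_eq_norm]
    exact mul_le_mul_of_nonneg_left (hδ x hx _ (hsX _) (hsc x hx).symm) (by positivity)
  have h3 : Integrable (fun x => ∫ ω, ‖(V ω - W ω) x‖ ^ 2 ∂P) μ :=
    (hD.integrable_norm_pow (by norm_num)).integral_prod_right
  simpa using integral_mono_ae h3 (integrable_const (2 * √d * C * δ)) h2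

/-- The tail bound for the eigenvalues of the covariance operator. -/
theorem KernelLipschitzOn.tsum_tail_le (hd : 0 < d) (hC : 0 ≤ C)
    (hK : KernelLipschitzOn X (covKernel P V) C)
    (hX : Bornology.IsBounded X) (hμ : ∀ᵐ x ∂μ, x ∈ X)
    (hVm : AEStronglyMeasurable (Function.uncurry V) (P.prod μ))
    (hV : ∀ x ∈ X, MemLp (fun ω => V ω x) 2 P) {lam : ℕ → ℝ} {φ : ℕ → FieldSpace μ}
    (hE : IsEigenSystem (covOp P μ V) lam φ) {K : ℕ} (hdK : d ≤ K) :
    ∑' m, lam (K + m) ≤ 8 * d ^ 2 * Metric.diam X * C * (K : ℝ) ^ (-(1 / (d : ℝ))) := by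
  have hd' : (1 : ℝ) ≤ d := by exact_mod_cast hd
  have hd0 : (0 : ℝ) < d := by linarith
  have hK0 : (0 : ℝ) < K := by exact_mod_cast hd.trans_le hdK
  -- The largest real grid size with `d * r ^ d ≤ K`; the condition `d ≤ K` ensures that its floor
  -- `n` is positive.
  set r : ℝ := ((K : ℝ) / d) ^ (1 / (d : ℝ)) with hr
  have hr1 : 1 ≤ r := Real.one_le_rpow ((one_le_div hd0).2 (by exact_mod_cast hdK)) (by positivity)
  have hrd : r ^ d = (K : ℝ) / d := by
    rw [hr, ← Real.rpow_natCast, ← Real.rpow_mul (by positivity), one_div_mul_cancel hd0.ne',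
      Real.rpow_one]
  set n := ⌊r⌋₊ with hn
  have hn0 : 0 < n := Nat.floor_pos.2 hr1
  have hn1 : (1 : ℝ) ≤ n := by exact_mod_cast hn0
  have hnr : (n : ℝ) ≤ r := Nat.floor_le (by linarith)
  have hrn : r ≤ 2 * n := by
    have := Nat.lt_floor_add_one r
    rw [← hn] at this
    linarith
  obtain ⟨c, hc, hcX⟩ := exists_measurable_partition hX hn0
  have hrank : Module.finrank ℝ (fibrewiseConst μ hc) ≤ K := by
    refine (finrank_fibrewiseConst_le hc).trans ?_
    rw [Fintype.card_fun, Fintype.card_fin, Fintype.card_fin]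
    have h1 : (n : ℝ) ^ d ≤ K / d := by
      rw [← hrd]
      exact pow_le_pow_left₀ (by linarith) hnr d
    rw [le_div_iff₀ hd0] at h1
    exact_mod_cast h1
  refine (IsEigenSystem.tsum_tail_le (memLp_fieldToLp (hK.memLp_prod hC hX hμ hVm hV)) hE
    (fibrewiseConst μ hc) hrank).trans ?_
  refine (hK.integral_norm_sub_fibrewiseConst_le hC hX hμ hVm hV hc hcX).trans ?_
  have hs : √(d : ℝ) * √d = d := Real.mul_self_sqrt hd0.le
  -- Rounding costs the factor `2`, and `d ^ (1 / d)` is bounded crudely by `d`.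
  have hinv : 1 / (n : ℝ) ≤ 2 * d * (K : ℝ) ^ (-(1 / (d : ℝ))) := by
    have h1 : r * (K : ℝ) ^ (-(1 / (d : ℝ))) = ((d : ℝ) ^ (1 / (d : ℝ)))⁻¹ := by
      rw [hr, Real.div_rpow hK0.le hd0.le, Real.rpow_neg hK0.le]
      have : (K : ℝ) ^ (1 / (d : ℝ)) ≠ 0 := (Real.rpow_pos_of_pos hK0 _).ne'
      field_simp
    have h2 : (d : ℝ) ^ (1 / (d : ℝ)) ≤ d := by
      conv_rhs => rw [← Real.rpow_one (d : ℝ)]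
      exact Real.rpow_le_rpow_of_exponent_le hd' ((div_le_one hd0).2 hd')
    have h3 : (d : ℝ)⁻¹ ≤ r * (K : ℝ) ^ (-(1 / (d : ℝ))) := by
      rw [h1]
      exact inv_anti₀ (Real.rpow_pos_of_pos hd0 _) h2
    have h4 : 0 ≤ (K : ℝ) ^ (-(1 / (d : ℝ))) := Real.rpow_nonneg hK0.le _
    have h5 : (d : ℝ)⁻¹ ≤ 2 * n * (K : ℝ) ^ (-(1 / (d : ℝ))) :=
      h3.trans (mul_le_mul_of_nonneg_right hrn h4)
    rw [inv_le_iff_one_le_mul₀ hd0] at h5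
    rw [div_le_iff₀ (by linarith)]
    linarith
  have hD := Metric.diam_nonneg (s := X)
  calc 2 * √d * C * (√d * (2 * Metric.diam X / n))
      = 4 * (√d * √d) * C * Metric.diam X * (1 / n) := by ring
    _ = 4 * d * C * Metric.diam X * (1 / n) := by rw [hs]
    _ ≤ 4 * d * C * Metric.diam X * (2 * d * (K : ℝ) ^ (-(1 / (d : ℝ)))) :=
        mul_le_mul_of_nonneg_left hinv (by positivity)
    _ = 8 * d ^ 2 * Metric.diam X * C * (K : ℝ) ^ (-(1 / (d : ℝ))) := by ring

end Field

theorem mul_rpow_neg_le_of_div_pow_le {d : ℕ} (hd : 0 < d) {a b K : ℝ} (ha : 0 ≤ a) (hb : 0 < b)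
    (hK : 0 < K) (h : (a / b) ^ d ≤ K) : a * K ^ (-(1 / (d : ℝ))) ≤ b := by
  have hd0 : (d : ℝ) ≠ 0 := by exact_mod_cast hd.ne'
  have h1 : a / b ≤ K ^ (1 / (d : ℝ)) := by
    have h2 := Real.rpow_le_rpow (by positivity) h (by positivity : 0 ≤ 1 / (d : ℝ))
    rwa [← Real.rpow_natCast, ← Real.rpow_mul (by positivity), mul_one_div_cancel hd0,
      Real.rpow_one] at h2
  rw [Real.rpow_neg hK.le, ← div_eq_mul_inv, div_le_iff₀ (Real.rpow_pos_of_pos hK _)]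
  rw [div_le_iff₀ hb] at h1
  linarith

end

/-- Eigenvalue tail bound and `ε`-isometry for a random vector field `V` on a bounded domain
`X ⊆ ℝᵈ` whose covariance kernel is Lipschitz. The constant `A` depends only on `d`, and
`A_X = A * diam X`. Indices start at `0`, so `∑' m, lam (K + m)` is the sum of all eigenvalues
after the first `K`. -/
theorem mainTheorem3 (d : ℕ) (hd : 0 < d) :
    ∃ A : ℝ, 0 < A ∧
      ∀ (Ω : Type*) [MeasurableSpace Ω] (P : Measure Ω) [IsProbabilityMeasure P]
        (X : Set (EuclideanSpace ℝ (Fin d))) (_ : Bornology.IsBounded X)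
        (μ : Measure (EuclideanSpace ℝ (Fin d))) [IsProbabilityMeasure μ] (_ : ∀ᵐ x ∂μ, x ∈ X)
        (V : Ω → EuclideanSpace ℝ (Fin d) → EuclideanSpace ℝ (Fin d))
        (_ : AEStronglyMeasurable (Function.uncurry V) (P.prod μ))
        (_ : ∀ x ∈ X, MemLp (fun ω => V ω x) 2 P),
        -- if the sample paths are Lipschitz, then so is the kernel, with constant `L * B₂`
        (∀ (L : NNReal) (B₂ : ℝ), 0 ≤ B₂ →
          (∀ᵐ ω ∂P, LipschitzOnWith L (V ω) X) →
          (∀ z ∈ X, ∫ ω, ‖V ω z‖ ^ 2 ∂P ≤ B₂ ^ 2) →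
          KernelLipschitzOn X (covKernel P V) (L * B₂)) ∧
        -- tail bound and reconstruction error for a kernel with Lipschitz constant `C`
        (∀ C : ℝ, 0 ≤ C → KernelLipschitzOn X (covKernel P V) C →
          ∀ (lam : ℕ → ℝ) (φ : ℕ → FieldSpace μ), IsEigenSystem (covOp P μ V) lam φ →
          ∀ K : ℕ, d ≤ K →
            (Summable lam ∧
              ∑' m, lam (K + m) ≤ A * Metric.diam X * C * (K : ℝ) ^ (-(1 / (d : ℝ)))) ∧
            (∀ ε : ℝ, 0 < ε → 0 < opTrace (covOp P μ V) →
              (A * Metric.diam X * C / (ε ^ 2 * opTrace (covOp P μ V))) ^ d ≤ (K : ℝ) →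
              Integrable (fun ω => ‖fieldToLp μ (V ω)‖ ^ 2) P ∧
              Integrable (fun ω => residualSq μ φ K (V ω)) P ∧
              ∫ ω, residualSq μ φ K (V ω) ∂P ≤
                ε ^ 2 * ∫ ω, ‖fieldToLp μ (V ω)‖ ^ 2 ∂P)) := by
  have hd' : (0 : ℝ) < d := Nat.cast_pos.2 hd
  refine ⟨8 * d ^ 2, by positivity, ?_⟩
  intro Ω _ P _ X hX μ _ hμ V hVm hV
  refine ⟨fun L B hB hL hVB => kernelLipschitzOn_of_lipschitzOnWith hV hB hL hVB, ?_⟩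
  intro C hC hK lam φ hE K hdK
  have hZ := memLp_fieldToLp (hK.memLp_prod hC hX hμ hVm hV)
  have htail := hK.tsum_tail_le hd hC hX hμ hVm hV hE hdK
  refine ⟨⟨IsEigenSystem.summable hZ hE, htail⟩, fun ε hε htr hKε => ?_⟩
  refine ⟨hZ.integrable_norm_pow (by norm_num),
    (hZ.sub ((principalSpan φ K).starProjection.comp_memLp' hZ)).integrable_norm_pow
      (by norm_num), ?_⟩
  have h1 := mul_rpow_neg_le_of_div_pow_le hd
    (by have := Metric.diam_nonneg (s := X); positivity) (by positivity)
    (by exact_mod_cast hd.trans_le hdK) hKε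
  calc ∫ ω, residualSq μ φ K (V ω) ∂P ≤ ∑' m, lam (K + m) :=
        IsEigenSystem.integral_residual_le hZ hE K
    _ ≤ ε ^ 2 * opTrace (covOp P μ V) := htail.trans h1
    -- Only this direction of the trace identity is needed.
    _ ≤ ε ^ 2 * ∫ ω, ‖fieldToLp μ (V ω)‖ ^ 2 ∂P :=
        mul_le_mul_of_nonneg_left (opTrace_secondMomentOp_le hZ) (by positivity)
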